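/- **System and specification.** Let $f:\mathbb R^n\times\mathbb R^m\to\mathbb R^n$ be a known Borel map, $U\subseteq\mathbb R^m$, and let $X_{k+1}=f(X_k,u_k)+W_k$, where $(W_k)_{k\ge 0}$ are i.i.d. with a density with respect to Lebesgue measure. The domain $\mathcal X\subset\mathbb R^n$ is partitioned into full-dimensional convex polytopes $Q_1,\dots,Q_N$ (which need not contain all their faces), with reference points $c_i\in Q_i$, and $Q_0=\mathrm{cl}(\mathbb R^n\setminus\mathcal X)$. Let $\mathcal X_G,\mathcal X_U$ (goal, unsafe) be unions of cells. For $x_0\in\mathbb R^n$ and a horizon $K$, the specification $\varphi^K_{x_0}$ says that, started at $x_0$, the state reaches $\mathcal X_G$ at some $k\le K$ and stays in $\mathcal X\setminus\mathcal X_U$ at all times up to $k$. **Actions.** Let $T_1,\dots,T_M\subseteq\{1,\dots,N\}$ be target sets that cover $\{1,\dots,N\}$, and $\mathrm{Pre}(y)=\{x\in\mathcal X:\exists u\in U,\ f(x,u)=y\}$. Action $a_r$ is enabled at $s_i$ ($1\le i\le N$) iff $Q_i\subseteq\bigcup_{j\in T_r}\mathrm{Pre}(c_j)$; no action is enabled at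 $s_0$. Let $c^*(x,a_r)$ be the $c_j$ of lowest index $j\in T_r$ with $x\in\mathrm{Pre}(c_j)$, and let $u^*$ be a control law with values in $U$, Borel in $x$, with $f(x,u^*(x,a_r))=c^*(x,a_r)$ whenever $c^*(x,a_r)$ exists. Let $L_r$ be the number of different reference points $c^*(x,a_r)$ for $x$ in the cells at which $a_r$ is enabled, and $L_{\max}=\max_r L_r$. Let $R(x)=s_i$ if $x\in Q_i$ for an $i\ge1$, and $R(x)=s_0$ if $x\notin\mathcal X$. **iMDP.** Let $\beta\in(0,1)$ and let $w=(w^{(1)},\dots,w^{(Z)})$ be i.i.d. samples of the noise. For a reference point $c$ and a state $s_j$ ($0\le j\le N$), let $z$ be the number of samples with $c+w^{(i)}\notin Q_j$. Let $\underline p_j(c)=0$ if $z=Z$, and otherwise the solution in $[0,1]$ of $\frac{\beta}{2Z}=\sum_{i=0}^{z}\binom Zi(1-p)^ip^{Z-i}$; let $\overline p_j(c)=1$ if $z=0$, and otherwise the solution in $[0,1]$ of $\frac{\beta}{2Z}=1-\sum_{i=0}^{z-1}\binom Zi(1-p)^ip^{Z-i}$. The robust MDP allows for the transition from $s_i$ to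 $s_j$ under an enabled action $a_r$ the probabilities in $\bigcup_{c}[\underline p_j(c),\overline p_j(c)]$, the union over all $c=c^*(x,a_r)$ with $x\in Q_i$; the iMDP $M_\updownarrow$, with states $s_0,\dots,s_N$, allows the interval from the minimum to the maximum of this set. States without enabled actions are absorbing. Policies $\pi$ are deterministic and time-varying and choose enabled actions whenever there are any. The worst case of a policy is the minimum of the probability of satisfying the corresponding specification from $R(x_0)$ over all sequences $(P_k)_{k\ge0}$ of transition functions consistent with $M_\updownarrow$ ($P_k$ is used at time $k$), and a policy is optimal if its worst case is maximal. **Theorem.** With probability at least $1-\alpha$ over the $Z$ noise samples, where $\alpha=\beta NML_{\max}$, the following holds for every optimal policy $\pi^*$ of $M_\updownarrow$ and every $\eta$: if the worst-case probability of satisfying the specification in $M_\updownarrow$ under $\pi^*$ is at least $\eta$, then under the feedback controller $\phi_k(x)=u^*(x,\pi^*(R(x),k))$ the stochastic difference equation satisfies $\varphi^K_{x_0}$ with probability at least $\eta$. -/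

import Mathlib

open MeasureTheory ProbabilityTheory Set
open scoped Classical

noncomputable section

/-! ### Reach-avoid specifications and interval Markov decision processes -/

/-- A run `ρ 0, …, ρ K` satisfies the reach-avoid specification with horizon `K`: it is in the goal
set at some step `k ≤ K` and outside the unsafe set at all steps up to `k`. -/
def ReachAvoid {S : Type*} {K : ℕ} (goal unsafeSet : Set S) (ρ : Fin (K + 1) → S) : Prop :=
  ∃ k, ρ k ∈ goal ∧ ∀ j ≤ k, ρ j ∉ unsafeSet

/-- The transition structure of an interval MDP: the actions enabled at each state, and for an
enabled action `a` at `s` the interval `[lo s a s', hi s a s']` for the probability of moving to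
`s'`. A state without an enabled action is absorbing, see `IMDP.Transitions`. -/
structure IMDP (S A : Type*) where
  enabled : S → Set A
  lo : S → A → S → ℝ
  hi : S → A → S → ℝ

namespace IMDP

variable {S A : Type*} [Fintype S]

/-- The transition probability functions that are consistent with the iMDP. -/
def Transitions (I : IMDP S A) : Set (S → A → S → ℝ) :=
  {P | ∀ s a,
    (a ∈ I.enabled s →
      P s a ∈ stdSimplex ℝ S ∧ ∀ s', P s a s' ∈ Icc (I.lo s a s') (I.hi s a s')) ∧
    (a ∉ I.enabled s → P s a = Pi.single s 1)}

/-- The choices of nature: at every time step a transition probability function that is consistent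
with the iMDP. This is the dynamic semantics, the one evaluated by robust value iteration. -/
def Natures (I : IMDP S A) : Set (ℕ → S → A → S → ℝ) :=
  {P | ∀ k, P k ∈ I.Transitions}

/-- Deterministic time-varying policies that pick an enabled action whenever there is one. -/
def Admissible (I : IMDP S A) : Set (S → ℕ → A) :=
  {π | ∀ s k, (I.enabled s).Nonempty → π s k ∈ I.enabled s}

/-- The probability that the Markov chain started at `s₀` and driven by the policy `π` and the
transition probabilities `P k` (at time `k`) satisfies the reach-avoid specification: the sum of the
probabilities of all satisfying runs. -/
def prob (K : ℕ) (goal unsafeSet : Set S) (s₀ : S) (π : S → ℕ → A) (P : ℕ → S → A → S → ℝ) : ℝ :=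
  ∑ ρ : Fin (K + 1) → S,
    if ρ 0 = s₀ ∧ ReachAvoid goal unsafeSet ρ then
      ∏ k : Fin K, P k (ρ k.castSucc) (π (ρ k.castSucc) k) (ρ k.succ)
    else 0

/-- The worst-case probability over all choices of nature. -/
def worstProb (I : IMDP S A) (K : ℕ) (goal unsafeSet : Set S) (s₀ : S) (π : S → ℕ → A) : ℝ :=
  sInf (prob K goal unsafeSet s₀ π '' I.Natures)

/-- `π` maximizes the worst-case probability among all admissible policies. -/
def IsOptimal (I : IMDP S A) (K : ℕ) (goal unsafeSet : Set S) (s₀ : S) (π : S → ℕ → A) : Prop :=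
  π ∈ I.Admissible ∧ ∀ π' ∈ I.Admissible,
    I.worstProb K goal unsafeSet s₀ π' ≤ I.worstProb K goal unsafeSet s₀ π

end IMDP

/-! ### Sample-based probability intervals -/

/-- The lower end of the probability interval for `Z` samples, `k` of which lie outside the region.
For `0 < β < 1` and `k < Z` the equation has exactly one solution in `[0, 1]`, which `sSup` picks. -/
def pLower (Z : ℕ) (β : ℝ) (k : ℕ) : ℝ :=
  if k = Z then 0 else
    sSup {p ∈ Icc (0 : ℝ) 1 |
      β / (2 * Z) = ∑ i ∈ Finset.range (k + 1), (Z.choose i : ℝ) * (1 - p) ^ i * p ^ (Z - i)}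

/-- The upper end of the probability interval for `Z` samples, `k` of which lie outside the region.
For `0 < β < 1` and `0 < k ≤ Z` the equation has exactly one solution in `[0, 1]`. -/
def pUpper (Z : ℕ) (β : ℝ) (k : ℕ) : ℝ :=
  if k = 0 then 1 else
    sSup {p ∈ Icc (0 : ℝ) 1 |
      β / (2 * Z) = 1 - ∑ i ∈ Finset.range k, (Z.choose i : ℝ) * (1 - p) ^ i * p ^ (Z - i)}

/-! ### The multi-target abstraction -/

/-- A cell of a partition into full-dimensional convex polytopes. As the cells of a partition are
disjoint, a cell need not contain all of its faces; its closure is a polytope. -/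
structure IsPolytopeCell {n : ℕ} (Q : Set (EuclideanSpace ℝ (Fin n))) : Prop where
  measurableSet : MeasurableSet Q
  convex : Convex ℝ Q
  interior_nonempty : (interior Q).Nonempty
  closure_eq : ∃ F : Finset (EuclideanSpace ℝ (Fin n)),
    closure Q = convexHull ℝ (F : Set (EuclideanSpace ℝ (Fin n)))

/-- The data of the abstraction: nominal dynamics `f`, input set `U`, the cells `Q i` of a partition
of the domain, reference points `c i ∈ Q i`, and target sets `T r` (sets of cells, given by their
indices) that cover the partition. -/
structure MultiTarget (n m N M : ℕ) where
  f : EuclideanSpace ℝ (Fin n) → EuclideanSpace ℝ (Fin m) → EuclideanSpace ℝ (Fin n)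
  U : Set (EuclideanSpace ℝ (Fin m))
  Q : Fin N → Set (EuclideanSpace ℝ (Fin n))
  polytope : ∀ i, IsPolytopeCell (Q i)
  disjoint : ∀ i j, i ≠ j → Disjoint (Q i) (Q j)
  c : Fin N → EuclideanSpace ℝ (Fin n)
  c_mem : ∀ i, c i ∈ Q i
  T : Fin M → Finset (Fin N)
  cover : ∀ i, ∃ r, i ∈ T r

namespace MultiTarget

variable {n m N M : ℕ} (D : MultiTarget n m N M)

/-- The domain, partitioned by the cells. -/
def domain : Set (EuclideanSpace ℝ (Fin n)) := ⋃ i, D.Q i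

/-- The union of the cells with index in `G`. -/
def cells (G : Set (Fin N)) : Set (EuclideanSpace ℝ (Fin n)) := ⋃ i ∈ G, D.Q i

/-- The region of an abstract state. The state `some i` stands for the cell `Q i`, the state `none`
for the absorbing region, the closure of the complement of the domain. -/
def region : Option (Fin N) → Set (EuclideanSpace ℝ (Fin n))
  | some i => D.Q i
  | none => closure D.domainᶜ

/-- The abstract state of a point: its cell if it lies in the domain, else the absorbing state. -/
def absState (x : EuclideanSpace ℝ (Fin n)) : Option (Fin N) :=
  if h : ∃ i, x ∈ D.Q i then some h.choose else none

/-- The nominal backward reachable set of a point. -/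
def Pre (y : EuclideanSpace ℝ (Fin n)) : Set (EuclideanSpace ℝ (Fin n)) :=
  {x ∈ D.domain | ∃ u ∈ D.U, D.f x u = y}

/-- The enabled actions: `r` is enabled at the cell `i` if `Q i` is contained in the backward
reachable set of the reference points of `T r`. The absorbing state has none. -/
def enabled : Option (Fin N) → Set (Fin M)
  | some i => {r | D.Q i ⊆ ⋃ j ∈ D.T r, D.Pre (D.c j)}
  | none => ∅

/-- `c j` is the reference point selected at `x` under action `r`: the one of lowest index among
those of `T r` that can be reached from `x` under the nominal dynamics. -/
def Selects (x : EuclideanSpace ℝ (Fin n)) (r : Fin M) (j : Fin N) : Prop :=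
  IsLeast {j | j ∈ D.T r ∧ x ∈ D.Pre (D.c j)} j

/-- The (indices of) reference points selected from points of the cell `i` under action `r`; these
correspond to the pieces of the partition of `Q i` induced by the selection. -/
def selected (i : Fin N) (r : Fin M) : Set (Fin N) := {j | ∃ x ∈ D.Q i, D.Selects x r j}

/-- The number of different reference points that are selected under action `r`. -/
def L (r : Fin M) : ℕ := {j | ∃ i, r ∈ D.enabled (some i) ∧ j ∈ D.selected i r}.ncard

/-- The largest `L r`. -/
def Lmax : ℕ := Finset.univ.sup D.L

/-- A control law with values in `U` that steers the nominal dynamics from `x` to the selected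
reference point. -/
def IsControlLaw (u : EuclideanSpace ℝ (Fin n) → Fin M → EuclideanSpace ℝ (Fin m)) : Prop :=
  (∀ x r, u x r ∈ D.U) ∧ ∀ x r j, D.Selects x r j → D.f x (u x r) = D.c j

/-- The number of samples that fall outside the region of `s` when shifted by `c j`. -/
def numOut {Z : ℕ} (w : Fin Z → EuclideanSpace ℝ (Fin n)) (j : Fin N) (s : Option (Fin N)) : ℕ :=
  Z - (Finset.univ.filter fun i => D.c j + w i ∈ D.region s).card

/-- The robust MDP: the set of values allowed for the probability of moving from the cell `i` to the
state `s` under action `r` is the union, over the selected reference points, of the sample-based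
intervals. -/
def robustSet {Z : ℕ} (β : ℝ) (w : Fin Z → EuclideanSpace ℝ (Fin n)) (i : Fin N) (r : Fin M)
    (s : Option (Fin N)) : Set ℝ :=
  ⋃ j ∈ D.selected i r, Icc (pLower Z β (D.numOut w j s)) (pUpper Z β (D.numOut w j s))

/-- The iMDP in which the robust MDP is embedded. The interval ends given here for the absorbing
state are never used, as no action is enabled there. -/
def imdp {Z : ℕ} (β : ℝ) (w : Fin Z → EuclideanSpace ℝ (Fin n)) : IMDP (Option (Fin N)) (Fin M) where
  enabled := D.enabled
  lo s r s' := s.elim 0 fun i => sInf (D.robustSet β w i r s')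
  hi s r s' := s.elim 0 fun i => sSup (D.robustSet β w i r s')

/-- The refined feedback controller `φ(x) = u(x, π(R(x), k))`. -/
def controller (u : EuclideanSpace ℝ (Fin n) → Fin M → EuclideanSpace ℝ (Fin m))
    (π : Option (Fin N) → ℕ → Fin M) (k : ℕ) (x : EuclideanSpace ℝ (Fin n)) :
    EuclideanSpace ℝ (Fin m) :=
  u x (π (D.absState x) k)

/-- The stochastic difference equation `X (k+1) = f (X k) (φ k (X k)) + W k` started at `x₀`. -/
def traj {Ω : Type*} (W : ℕ → Ω → EuclideanSpace ℝ (Fin n))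
    (φ : ℕ → EuclideanSpace ℝ (Fin n) → EuclideanSpace ℝ (Fin m))
    (x₀ : EuclideanSpace ℝ (Fin n)) : ℕ → Ω → EuclideanSpace ℝ (Fin n)
  | 0, _ => x₀
  | k + 1, ω => D.f (traj W φ x₀ k ω) (φ k (traj W φ x₀ k ω)) + W k ω

/-- The event that the controlled system started at `x₀` satisfies the specification: it reaches a
goal cell within `K` steps, and up to then stays in the domain and outside the unsafe cells. -/
def satEvent {Ω : Type*} (W : ℕ → Ω → EuclideanSpace ℝ (Fin n)) (K : ℕ) (G B : Set (Fin N))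
    (φ : ℕ → EuclideanSpace ℝ (Fin n) → EuclideanSpace ℝ (Fin m))
    (x₀ : EuclideanSpace ℝ (Fin n)) : Set Ω :=
  {ω | ReachAvoid (D.cells G) (D.cells B ∪ D.domainᶜ)
    fun k : Fin (K + 1) => D.traj W φ x₀ k ω}

end MultiTarget

end

/-!
The number of samples outside of a region is binomially distributed, and the binomial distribution
function is monotone in the success probability. Hence each end of an interval excludes the true
transition probability with probability at most `β / (2 * Z)` (Clopper–Pearson), and the two ends
together do so with probability at most `β / 2`: for `Z = 1` because they cannot both fail
(`measureReal_notMem_Icc_le`). There are at most `M * Lmax` selected reference points and `N + 1`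
abstract states, so that by the union bound all intervals are correct except with probability
`M * Lmax * (N + 1) * β / 2 ≤ β * N * M * Lmax`. The samples are counted in the closure of the
complement of the domain, the dynamics uses the complement itself; as the frontier of a convex set
is a null set and the noise has a density, the probabilities agree
(`MultiTarget.transProb_eq_region`).

Suppose that all intervals are correct. The abstract state of the controlled system is not a Markov
chain: from the cell `Q i` it moves with the distribution that belongs to the reference point
selected at the current continuous state, which depends on the past. For any function `v` of the
next abstract state, however, its conditional expectation is at least the minimum over the selected
reference points of the expectation of `v`, and the minimizing distribution is a consistent choice
of nature. Making this choice backwards in time, with `v` the satisfaction probability of the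
remaining steps, yields a nature under which the iMDP satisfies the specification with at most the
probability of the controlled system (`IMDP.exists_nature_mul_prob_le`). The worst case over
all natures is at most that. The minima are attained because the set of selected reference points is
finite.
-/

/-! ### Clopper–Pearson intervals -/

/-- The probability of fewer than `m` failures in `Z` independent trials, each of which
succeeds with probability `p`. -/
noncomputable def binomialLT (Z m : ℕ) (p : ℝ) : ℝ :=
  ∑ i ∈ Finset.range m, (Z.choose i : ℝ) * (1 - p) ^ i * p ^ (Z - i)

/-- Conditioning on the outcome of one of the trials. -/
lemma binomialLT_succ_succ (Z m : ℕ) (p : ℝ) :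
    binomialLT (Z + 1) (m + 1) p = p * binomialLT Z (m + 1) p + (1 - p) * binomialLT Z m p := by
  unfold binomialLT
  rw [Finset.sum_range_succ', Finset.sum_range_succ', mul_add, Finset.mul_sum, Finset.mul_sum,
    add_right_comm, ← Finset.sum_add_distrib]
  congr 1
  · refine Finset.sum_congr rfl fun i _ => ?_
    rw [Nat.choose_succ_succ, Nat.add_sub_add_right]
    push_cast
    rcases lt_or_ge i Z with h | h
    · obtain ⟨d, rfl⟩ := Nat.exists_eq_add_of_lt h
      rw [show i + d + 1 - i = d + 1 by omega, show i + d + 1 - (i + 1) = d by omega]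
      ring
    · rw [Nat.choose_eq_zero_of_lt (Nat.lt_succ_of_le h)]
      push_cast
      ring
  · simp only [Nat.choose_zero_right, pow_zero, Nat.sub_zero]
    push_cast
    ring

lemma binomialLT_le_succ (Z m : ℕ) {p : ℝ} (h0 : 0 ≤ p) (h1 : p ≤ 1) :
    binomialLT Z m p ≤ binomialLT Z (m + 1) p := by
  unfold binomialLT
  rw [Finset.sum_range_succ]
  have : 0 ≤ 1 - p := by linarith
  exact le_add_of_nonneg_right (by positivity)

/-- Failures become less likely as the success probability grows. -/
lemma binomialLT_mono (Z m : ℕ) {p q : ℝ} (h0 : 0 ≤ p) (hpq : p ≤ q) (h1 : q ≤ 1) :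
    binomialLT Z m p ≤ binomialLT Z m q := by
  induction Z generalizing m with
  | zero =>
    refine Finset.sum_le_sum fun i _ => ?_
    cases i <;> simp
  | succ Z ih =>
    cases m with
    | zero => simp [binomialLT]
    | succ m =>
      rw [binomialLT_succ_succ, binomialLT_succ_succ]
      nlinarith [mul_le_mul_of_nonneg_left (ih (m + 1)) h0,
        mul_le_mul_of_nonneg_left (ih m) (show 0 ≤ 1 - p by linarith),
        mul_nonneg (sub_nonneg.2 hpq) (sub_nonneg.2 (binomialLT_le_succ Z m (h0.trans hpq) h1))]

lemma binomialLT_zero_right {Z m : ℕ} (h : m ≤ Z) : binomialLT Z m 0 = 0 :=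
  Finset.sum_eq_zero fun i hi => by
    have : Z - i ≠ 0 := by have := Finset.mem_range.1 hi; omega
    simp [this]

lemma binomialLT_one_right {Z m : ℕ} (h : m ≠ 0) : binomialLT Z m 1 = 1 := by
  obtain ⟨m, rfl⟩ := Nat.exists_eq_succ_of_ne_zero h
  rw [binomialLT, Finset.sum_range_succ', Finset.sum_eq_zero fun i _ => by simp]
  simp

lemma binomialLT_of_lt_pLower {Z k : ℕ} {β q : ℝ} (hq : 0 ≤ q) (h : q < pLower Z β k) :
    k ≠ Z ∧ binomialLT Z (k + 1) q ≤ β / (2 * Z) := by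
  rw [pLower] at h
  split_ifs at h with hk
  · exact absurd h hq.not_gt
  refine ⟨hk, ?_⟩
  rcases Set.eq_empty_or_nonempty {p ∈ Icc (0 : ℝ) 1 | β / (2 * Z) =
    ∑ i ∈ Finset.range (k + 1), (Z.choose i : ℝ) * (1 - p) ^ i * p ^ (Z - i)} with he | hne
  · rw [he, Real.sSup_empty] at h
    exact absurd h hq.not_gt
  · obtain ⟨p, ⟨hp, hpe⟩, hqp⟩ := exists_lt_of_lt_csSup hne h
    rw [hpe]
    exact binomialLT_mono Z (k + 1) hq hqp.le hp.2

lemma one_sub_binomialLT_of_pUpper_lt {Z k : ℕ} {β q : ℝ} (hβ0 : 0 ≤ β) (hβ1 : β ≤ 1) (hZ : k ≤ Z)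
    (hq : q ≤ 1) (h : pUpper Z β k < q) :
    k ≠ 0 ∧ 1 - binomialLT Z k q ≤ β / (2 * Z) := by
  rw [pUpper] at h
  split_ifs at h with hk
  · exact absurd h hq.not_gt
  refine ⟨hk, ?_⟩
  have hZ1 : (1 : ℝ) ≤ Z := by exact_mod_cast (Nat.pos_of_ne_zero hk).trans_le hZ
  have hb : β / (2 * Z) ∈ Icc (0 : ℝ) 1 :=
    ⟨by positivity, (div_le_one (by positivity)).2 (by linarith)⟩
  have hc : ContinuousOn (fun p => 1 - binomialLT Z k p) (Icc 0 1) := by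
    unfold binomialLT
    fun_prop
  -- a solution exists by the intermediate value theorem, so that the supremum is not a junk value
  obtain ⟨p, hp, hpe⟩ := intermediate_value_Icc' zero_le_one hc
    (by simpa [binomialLT_zero_right hZ, binomialLT_one_right hk] using hb)
  have hle := le_csSup (s := {p ∈ Icc (0 : ℝ) 1 | β / (2 * Z) =
    1 - ∑ i ∈ Finset.range k, (Z.choose i : ℝ) * (1 - p) ^ i * p ^ (Z - i)})
    ⟨1, fun x hx => hx.1.2⟩ ⟨hp, hpe.symm⟩
  have := binomialLT_mono Z k hp.1 (hle.trans h.le) hq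
  simp only at hpe
  linarith

section Samples

variable {E : Type*} {A : Set E}

/-- The number of samples outside of `A`. -/
noncomputable def numNotMem {Z : ℕ} (A : Set E) (w : Fin Z → E) : ℕ :=
  Z - (Finset.univ.filter fun i => w i ∈ A).card

lemma numNotMem_le {Z : ℕ} (w : Fin Z → E) : numNotMem A w ≤ Z := Nat.sub_le _ _

lemma numNotMem_eq_card {Z : ℕ} (w : Fin Z → E) :
    numNotMem A w = (Finset.univ.filter fun i => w i ∉ A).card := by
  have := Finset.card_filter_add_card_filter_not (s := Finset.univ) fun i => w i ∈ A
  rw [Finset.card_univ, Fintype.card_fin] at this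
  unfold numNotMem
  omega

lemma setOf_filter_notMem_eq {Z : ℕ} (T : Finset (Fin Z)) :
    {w : Fin Z → E | (Finset.univ.filter fun i => w i ∉ A) = T} =
      univ.pi fun i => if i ∈ T then Aᶜ else A := by
  ext w
  simp only [mem_ofPred_eq, Finset.ext_iff, Finset.mem_filter, Finset.mem_univ, true_and, mem_pi,
    mem_univ, forall_const]
  refine forall_congr' fun i => ?_
  split_ifs with h <;> simp [h]

variable [MeasurableSpace E] (ν : Measure E) [IsProbabilityMeasure ν]

lemma measurableSet_filter_notMem_eq {Z : ℕ} (hA : MeasurableSet A) (T : Finset (Fin Z)) :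
    MeasurableSet {w : Fin Z → E | (Finset.univ.filter fun i => w i ∉ A) = T} := by
  rw [setOf_filter_notMem_eq]
  exact MeasurableSet.univ_pi fun i => by split_ifs; exacts [hA.compl, hA]

lemma measurableSet_numNotMem_lt {Z : ℕ} (hA : MeasurableSet A) (m : ℕ) :
    MeasurableSet {w : Fin Z → E | numNotMem A w < m} := by
  have : {w : Fin Z → E | numNotMem A w < m} =
      ⋃ T ∈ {T : Finset (Fin Z) | T.card < m},
        {w : Fin Z → E | (Finset.univ.filter fun i => w i ∉ A) = T} := by
    ext w
    simp [numNotMem_eq_card]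
  rw [this]
  exact MeasurableSet.biUnion (Set.to_countable _) fun T _ => measurableSet_filter_notMem_eq hA T

/-- The number of samples outside of `A` is binomially distributed. -/
lemma measureReal_numNotMem_lt (Z m : ℕ) (hA : MeasurableSet A) :
    (Measure.pi fun _ : Fin Z => ν).real {w | numNotMem A w < m} = binomialLT Z m (ν.real A) := by
  have hset : {w : Fin Z → E | numNotMem A w < m} =
      ⋃ T ∈ Finset.univ.powerset.filter (fun T : Finset (Fin Z) => T.card < m),
        {w : Fin Z → E | (Finset.univ.filter fun i => w i ∉ A) = T} := by
    ext w
    simp [numNotMem_eq_card]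
  have hpt : ∀ T : Finset (Fin Z), (Measure.pi fun _ : Fin Z => ν).real
      {w : Fin Z → E | (Finset.univ.filter fun i => w i ∉ A) = T} =
      (1 - ν.real A) ^ T.card * ν.real A ^ (Z - T.card) := by
    intro T
    rw [setOf_filter_notMem_eq, measureReal_def, Measure.pi_pi, ENNReal.toReal_prod]
    simp only [apply_ite ν, apply_ite ENNReal.toReal, ← measureReal_def,
      probReal_compl_eq_one_sub hA]
    rw [Finset.prod_ite, Finset.prod_const, Finset.prod_const, Finset.filter_not,
      Finset.card_sdiff_of_subset (Finset.filter_subset _ _)]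
    simp
  rw [hset, measureReal_biUnion_finset]
  · simp only [hpt]
    rw [Finset.sum_filter, Finset.sum_powerset_apply_card
      (fun i => if i < m then (1 - ν.real A) ^ i * ν.real A ^ (Z - i) else 0), Finset.card_univ,
      Fintype.card_fin, binomialLT]
    simp only [nsmul_eq_mul, mul_ite, mul_zero, ← mul_assoc]
    rw [← Finset.sum_filter]
    -- the summands with `Z < i` vanish, so that both ranges can be cut off at `Z + 1`
    have h0 : ∀ i ∈ Finset.range m, i ∉ Finset.filter (fun i => i < m) (Finset.range (Z + 1)) →
        (Z.choose i : ℝ) * (1 - ν.real A) ^ i * ν.real A ^ (Z - i) = 0 := by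
      intro i hi hi'
      rw [Nat.choose_eq_zero_of_lt]
      · simp
      · simp only [Finset.mem_filter, Finset.mem_range] at hi hi'
        omega
    exact Finset.sum_subset (fun i hi => Finset.mem_range.2 (Finset.mem_filter.1 hi).2) h0
  · intro T _ T' _ hne
    exact Set.disjoint_left.2 fun w hw hw' => hne (hw.symm.trans hw')
  · exact fun T _ => measurableSet_filter_notMem_eq hA T

lemma measureReal_lt_pLower (Z : ℕ) {β : ℝ} (hβ : 0 ≤ β) (hA : MeasurableSet A) :
    (Measure.pi fun _ : Fin Z => ν).real {w | ν.real A < pLower Z β (numNotMem A w)} ≤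
      β / (2 * Z) := by
  by_cases h : ((Finset.range (Z + 1)).filter fun k => ν.real A < pLower Z β k).Nonempty
  · obtain ⟨m, hm, hmax⟩ := Finset.exists_max_image _ id h
    refine le_trans (measureReal_mono fun w hw => ?_)
      ((measureReal_numNotMem_lt ν Z (m + 1) hA).trans_le
        (binomialLT_of_lt_pLower measureReal_nonneg (Finset.mem_filter.1 hm).2).2)
    exact Nat.lt_succ_of_le (hmax _ (Finset.mem_filter.2
      ⟨Finset.mem_range.2 (Nat.lt_succ_of_le (numNotMem_le w)), hw⟩))
  · rw [show {w : Fin Z → E | ν.real A < pLower Z β (numNotMem A w)} = ∅ from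
      Set.eq_empty_of_forall_notMem fun w hw => h ⟨_, Finset.mem_filter.2
        ⟨Finset.mem_range.2 (Nat.lt_succ_of_le (numNotMem_le w)), hw⟩⟩, measureReal_empty]
    positivity

lemma measureReal_pUpper_lt (Z : ℕ) {β : ℝ} (hβ : 0 ≤ β) (hβ1 : β ≤ 1) (hA : MeasurableSet A) :
    (Measure.pi fun _ : Fin Z => ν).real {w | pUpper Z β (numNotMem A w) < ν.real A} ≤
      β / (2 * Z) := by
  by_cases h : ((Finset.range (Z + 1)).filter fun k => pUpper Z β k < ν.real A).Nonempty
  · obtain ⟨m, hm, hmin⟩ := Finset.exists_min_image _ id h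
    have hmZ := Nat.lt_succ_iff.1 (Finset.mem_range.1 (Finset.mem_filter.1 hm).1)
    refine le_trans (measureReal_mono (s₂ := {w : Fin Z → E | numNotMem A w < m}ᶜ)
      fun w hw => ?_) ?_
    · exact not_lt.2 (hmin _ (Finset.mem_filter.2
        ⟨Finset.mem_range.2 (Nat.lt_succ_of_le (numNotMem_le w)), hw⟩))
    · rw [probReal_compl_eq_one_sub (measurableSet_numNotMem_lt hA m),
        measureReal_numNotMem_lt ν Z m hA]
      exact (one_sub_binomialLT_of_pUpper_lt hβ hβ1 hmZ measureReal_le_one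
        (Finset.mem_filter.1 hm).2).2
  · rw [show {w : Fin Z → E | pUpper Z β (numNotMem A w) < ν.real A} = ∅ from
      Set.eq_empty_of_forall_notMem fun w hw => h ⟨_, Finset.mem_filter.2
        ⟨Finset.mem_range.2 (Nat.lt_succ_of_le (numNotMem_le w)), hw⟩⟩, measureReal_empty]
    positivity

/-- Each of the two ends of the interval fails with probability at most `β / (2 * Z)`. For `Z = 1`
this gives only the bound `β` for both together, but then at most one of them can fail. -/
lemma measureReal_notMem_Icc_le (Z : ℕ) {β : ℝ} (hβ : 0 < β) (hβ1 : β < 1) (hA : MeasurableSet A) :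
    (Measure.pi fun _ : Fin Z => ν).real
      {w | ν.real A ∉ Icc (pLower Z β (numNotMem A w)) (pUpper Z β (numNotMem A w))} ≤ β / 2 := by
  set q := ν.real A
  have hq0 : 0 ≤ q := measureReal_nonneg
  have hq1 : q ≤ 1 := measureReal_le_one
  have hlo := measureReal_lt_pLower ν Z hβ.le hA
  have hup := measureReal_pUpper_lt ν Z hβ.le hβ1.le hA
  have hunion : {w : Fin Z → E |
      q ∉ Icc (pLower Z β (numNotMem A w)) (pUpper Z β (numNotMem A w))} =
      {w | q < pLower Z β (numNotMem A w)} ∪ {w | pUpper Z β (numNotMem A w) < q} := by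
    ext w
    simp only [mem_ofPred_eq, mem_Icc, mem_union, not_and_or, not_le]
  rw [hunion]
  rcases Nat.lt_trichotomy Z 1 with hZ | rfl | hZ
  · obtain rfl : Z = 0 := by omega
    refine (measureReal_union_le _ _).trans ((add_le_add hlo hup).trans ?_)
    simpa using (half_pos hβ).le
  · rw [Nat.cast_one, mul_one] at hlo hup
    by_cases h : ∃ w : Fin 1 → E, pUpper 1 β (numNotMem A w) < q
    · obtain ⟨w, hw⟩ := h
      rw [show {w : Fin 1 → E | q < pLower 1 β (numNotMem A w)} = ∅ from ?_, empty_union]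
      · exact hup
      refine Set.eq_empty_of_forall_notMem fun w' hw' => ?_
      obtain ⟨h1, h2⟩ := one_sub_binomialLT_of_pUpper_lt hβ.le hβ1.le (numNotMem_le w) hq1 hw
      obtain ⟨h3, h4⟩ := binomialLT_of_lt_pLower hq0 hw'
      have e1 : numNotMem A w = 1 := by have := numNotMem_le (A := A) w; omega
      have e2 : numNotMem A w' = 0 := by have := numNotMem_le (A := A) w'; omega
      rw [e1] at h2
      rw [e2] at h4
      simp only [zero_add, Nat.cast_one, mul_one] at h2 h4
      linarith
    · rw [show {w : Fin 1 → E | pUpper 1 β (numNotMem A w) < q} = ∅ from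
        Set.eq_empty_of_forall_notMem fun w hw => h ⟨w, hw⟩, union_empty]
      exact hlo
  · refine (measureReal_union_le _ _).trans ((add_le_add hlo hup).trans ?_)
    have hZ2 : (2 : ℝ) ≤ Z := by exact_mod_cast hZ
    rw [← add_div, div_le_div_iff₀ (by positivity) (by positivity)]
    nlinarith

end Samples

/-! ### Reach-avoid probabilities in an interval Markov decision process -/

lemma sum_measureReal_inter_eq {α ι : Type*} [Fintype ι] [MeasurableSpace α] (μ : Measure α)
    [IsFiniteMeasure μ] {C : Set α} {A : ι → Set α} (hA : ∀ i, MeasurableSet (A i))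
    (hd : Pairwise fun i j => Disjoint (A i) (A j)) (hC : C ⊆ ⋃ i, A i) :
    ∑ i, μ.real (C ∩ A i) = μ.real C := by
  have hrw : ∀ i, μ.real (C ∩ A i) = (μ.restrict C).real (A i) := fun i => by
    rw [measureReal_restrict_apply (hA i), inter_comm]
  simp only [hrw]
  rw [← measureReal_biUnion_finset (fun i _ j _ h => hd h) fun i _ => hA i]
  simp only [Finset.mem_univ, iUnion_true]
  rw [measureReal_restrict_apply (MeasurableSet.iUnion hA), inter_eq_right.2 hC]

lemma reachAvoid_zero {S : Type*} {goal bad : Set S} {ρ : Fin (0 + 1) → S} :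
    ReachAvoid goal bad ρ ↔ ρ 0 ∈ goal ∧ ρ 0 ∉ bad := by
  simp [ReachAvoid, Fin.exists_fin_one, Fin.forall_fin_one]

lemma reachAvoid_succ {S : Type*} {K : ℕ} {goal bad : Set S} {ρ : Fin (K + 1 + 1) → S} :
    ReachAvoid goal bad ρ ↔
      ρ 0 ∉ bad ∧ (ρ 0 ∈ goal ∨ ReachAvoid goal bad fun k : Fin (K + 1) => ρ k.succ) := by
  unfold ReachAvoid
  rw [Fin.exists_fin_succ]
  simp only [Fin.forall_fin_succ, Fin.succ_le_succ_iff, Fin.zero_le,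
    Fin.le_zero_iff, Fin.succ_ne_zero, false_imp_iff, forall_const, and_true]
  constructor
  · rintro (⟨h1, h2⟩ | ⟨k, h1, h2, h3⟩)
    · exact ⟨h2, Or.inl h1⟩
    · exact ⟨h2, Or.inr ⟨k, h1, h3⟩⟩
  · rintro ⟨h2, h1 | ⟨k, h1, h3⟩⟩
    · exact Or.inl ⟨h1, h2⟩
    · exact Or.inr ⟨k, h1, h2, h3⟩

namespace IMDP

variable {S A : Type*}

lemma prod_cons {K : ℕ} (s : S) (ρ : Fin (K + 1) → S) (π : S → ℕ → A) (P : ℕ → S → A → S → ℝ) :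
    ∏ k : Fin (K + 1), P k ((Fin.cons s ρ : Fin (K + 1 + 1) → S) k.castSucc)
        (π ((Fin.cons s ρ : Fin (K + 1 + 1) → S) k.castSucc) k)
        ((Fin.cons s ρ : Fin (K + 1 + 1) → S) k.succ) =
      P 0 s (π s 0) (ρ 0) * ∏ k : Fin K, P (k + 1) (ρ k.castSucc)
        (π (ρ k.castSucc) (k + 1)) (ρ k.succ) := by
  rw [Fin.prod_univ_succ]
  simp

variable [Fintype S]

lemma Transitions.mem_stdSimplex {I : IMDP S A} {P : S → A → S → ℝ} (hP : P ∈ I.Transitions)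
    (s : S) (a : A) : P s a ∈ stdSimplex ℝ S := by
  by_cases h : a ∈ I.enabled s
  · exact ((hP s a).1 h).1
  · rw [(hP s a).2 h]
    exact single_mem_stdSimplex ℝ s

lemma prob_zero (goal bad : Set S) (s : S) (π : S → ℕ → A) (P : ℕ → S → A → S → ℝ) :
    prob 0 goal bad s π P = if s ∈ goal ∧ s ∉ bad then 1 else 0 := by
  unfold prob
  rw [Fintype.sum_eq_single (fun _ => s)]
  · simp [reachAvoid_zero]
  · intro ρ hρ
    rw [if_neg]
    rintro ⟨h, -⟩
    exact hρ (funext fun i => by rw [Fin.fin_one_eq_zero i, h])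

/-- Summation over the runs from `s` splits into the first step and the remaining run. -/
lemma sum_runs_succ (K : ℕ) (s : S) (g : (Fin (K + 1 + 1) → S) → ℝ) :
    ∑ ρ, (if ρ 0 = s then g ρ else 0) =
      ∑ s' : S, ∑ ρ : Fin (K + 1) → S, if ρ 0 = s' then g (Fin.cons s ρ) else 0 := by
  rw [← (Fin.consEquiv fun _ => S).sum_comp, Fintype.sum_prod_type, Fintype.sum_eq_single s,
    Finset.sum_comm]
  · simp [Fin.consEquiv]
  · intro s' hs
    simp [Fin.consEquiv, hs]

lemma prob_eq_zero_of_mem (K : ℕ) {goal bad : Set S} {s : S} (hs : s ∈ bad) (π : S → ℕ → A)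
    (P : ℕ → S → A → S → ℝ) : prob K goal bad s π P = 0 := by
  refine Finset.sum_eq_zero fun ρ _ => if_neg ?_
  rintro ⟨h, k, -, hk⟩
  exact hk 0 (Fin.zero_le _) (h ▸ hs)

/-- One step of the Bellman recursion. -/
lemma prob_succ (K : ℕ) {goal bad : Set S} {s : S} (hg : s ∉ goal) (hb : s ∉ bad)
    (π : S → ℕ → A) (P : ℕ → S → A → S → ℝ) :
    prob (K + 1) goal bad s π P =
      ∑ s', P 0 s (π s 0) s' *
        prob K goal bad s' (fun s k => π s (k + 1)) (fun k => P (k + 1)) := by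
  unfold prob
  simp only [ite_and]
  rw [sum_runs_succ K s fun ρ => if ReachAvoid goal bad ρ then
    ∏ k : Fin (K + 1), P k (ρ k.castSucc) (π (ρ k.castSucc) k) (ρ k.succ) else 0]
  refine Finset.sum_congr rfl fun s' _ => ?_
  rw [Finset.mul_sum]
  refine Finset.sum_congr rfl fun ρ _ => ?_
  rw [prod_cons]
  simp only [reachAvoid_succ, Fin.cons_zero, Fin.cons_succ, hg, hb, not_false_eq_true, true_and,
    false_or]
  split_ifs with h1 h2
  · rw [h1]
  · simp
  · simp

/-- The probabilities of all runs from `s` add up to one. -/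
lemma sum_runs_eq_one (K : ℕ) (s : S) (π : S → ℕ → A) (P : ℕ → S → A → S → ℝ)
    (hP : ∀ k s a, P k s a ∈ stdSimplex ℝ S) :
    ∑ ρ : Fin (K + 1) → S, (if ρ 0 = s then
      ∏ k : Fin K, P k (ρ k.castSucc) (π (ρ k.castSucc) k) (ρ k.succ) else 0) = 1 := by
  induction K generalizing s π P with
  | zero =>
    rw [Fintype.sum_eq_single (fun _ => s)]
    · simp
    · intro ρ hρ
      rw [if_neg]
      exact fun h => hρ (funext fun i => by rw [Fin.fin_one_eq_zero i, h])
  | succ K ih =>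
    rw [sum_runs_succ K s fun ρ =>
      ∏ k : Fin (K + 1), P k (ρ k.castSucc) (π (ρ k.castSucc) k) (ρ k.succ)]
    rw [← (hP 0 s (π s 0)).2]
    refine Finset.sum_congr rfl fun s' _ => ?_
    rw [← mul_one (P 0 s (π s 0) s'),
      ← ih s' (fun s k => π s (k + 1)) (fun k => P (k + 1)) fun k => hP (k + 1), Finset.mul_sum]
    refine Finset.sum_congr rfl fun ρ _ => ?_
    rw [prod_cons]
    split_ifs with h
    · rw [h]
    · simp

lemma prob_nonneg (K : ℕ) (goal bad : Set S) (s : S) (π : S → ℕ → A) (P : ℕ → S → A → S → ℝ)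
    (hP : ∀ k s a, P k s a ∈ stdSimplex ℝ S) : 0 ≤ prob K goal bad s π P :=
  Finset.sum_nonneg fun ρ _ => by
    split_ifs
    exacts [Finset.prod_nonneg fun k _ => (hP _ _ _).1 _, le_rfl]

lemma prob_le_one (K : ℕ) (goal bad : Set S) (s : S) (π : S → ℕ → A) (P : ℕ → S → A → S → ℝ)
    (hP : ∀ k s a, P k s a ∈ stdSimplex ℝ S) : prob K goal bad s π P ≤ 1 := by
  rw [← sum_runs_eq_one K s π P hP]
  refine Finset.sum_le_sum fun ρ _ => ?_
  rw [ite_and]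
  have : 0 ≤ ∏ k : Fin K, P k (ρ k.castSucc) (π (ρ k.castSucc) k) (ρ k.succ) :=
    Finset.prod_nonneg fun k _ => (hP _ _ _).1 _
  split_ifs <;> first | exact le_rfl | exact this

/-- From an absorbing state outside of the goal set, the goal set is never reached. -/
lemma prob_eq_zero_of_absorbing (I : IMDP S A) (K : ℕ) {goal bad : Set S} {s : S}
    (hs : I.enabled s = ∅) (hg : s ∉ goal) (π : S → ℕ → A) (P : ℕ → S → A → S → ℝ)
    (hP : P ∈ I.Natures) : prob K goal bad s π P = 0 := by
  by_cases hb : s ∈ bad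
  · exact prob_eq_zero_of_mem K hb π P
  induction K generalizing π P with
  | zero => rw [prob_zero, if_neg fun h => hg h.1]
  | succ K ih =>
    rw [prob_succ K hg hb, Fintype.sum_eq_single s]
    · rw [ih _ _ fun k => hP (k + 1), mul_zero]
    · intro s' hs'
      rw [(hP 0 s (π s 0)).2 (by simp [hs]), Pi.single_eq_of_ne hs', zero_mul]

lemma worstProb_le (I : IMDP S A) (K : ℕ) (goal bad : Set S) (s : S) (π : S → ℕ → A)
    {P : ℕ → S → A → S → ℝ} (hP : P ∈ I.Natures) :
    I.worstProb K goal bad s π ≤ prob K goal bad s π P :=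
  csInf_le ⟨0, by
    rintro _ ⟨P', hP', rfl⟩
    exact prob_nonneg K goal bad s π P' fun k => Transitions.mem_stdSimplex (hP' k)⟩ ⟨P, hP, rfl⟩

/-- Comparison of a process `X`, whose transitions may depend on the past, with the iMDP. The events
of `ℱ k` are those that depend on the past up to time `k`. Assume that for every time `k` and every
function `v` of the state, nature has a consistent choice `q` whose expected value of `v` at the
next step is at most that of the process, conditionally on every past event. Then choosing such a
`q` backwards in time, for the value of the remaining steps, gives a nature under which the iMDP
satisfies the specification with at most the probability of the process. The process may treat the
states of `bad'` as unsafe as well if these are absorbing and not in the goal set. -/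
lemma exists_nature_mul_prob_le {Ω : Type*} [MeasurableSpace Ω] (μ : Measure Ω)
    [IsProbabilityMeasure μ] (I : IMDP S A) (goal bad bad' : Set S) (X : ℕ → Ω → S)
    (ℱ : ℕ → MeasurableSpace Ω) (hmono : ∀ k, ℱ k ≤ ℱ (k + 1))
    (hle : ∀ k, ℱ k ≤ ‹MeasurableSpace Ω›) (hX : ∀ k s, MeasurableSet[ℱ k] (X k ⁻¹' {s}))
    (hbad' : ∀ s ∈ bad', s ∉ bad → I.enabled s = ∅ ∧ s ∉ goal)
    (π : S → ℕ → A)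
    (hstep : ∀ (k : ℕ) (v : S → ℝ), ∃ q ∈ I.Transitions, ∀ s, (I.enabled s).Nonempty →
      ∀ F, MeasurableSet[ℱ k] F → F ⊆ X k ⁻¹' {s} →
        μ.real F * ∑ s', q s (π s k) s' * v s' ≤
          ∑ s', μ.real (F ∩ X (k + 1) ⁻¹' {s'}) * v s')
    (K k₀ : ℕ) :
    ∃ P ∈ I.Natures, ∀ s F, MeasurableSet[ℱ k₀] F → F ⊆ X k₀ ⁻¹' {s} →
      μ.real F * prob K goal bad s (fun s k => π s (k₀ + k)) P ≤
        μ.real (F ∩ {ω | ReachAvoid goal bad' fun k : Fin (K + 1) => X (k₀ + k) ω}) := by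
  have good : ∀ {s}, (I.enabled s = ∅ → s ∈ goal) → s ∉ bad → s ∉ bad' := fun h hb hb' =>
    (hbad' _ hb' hb).2 (h (hbad' _ hb' hb).1)
  induction K generalizing k₀ with
  | zero =>
    obtain ⟨q, hq, -⟩ := hstep 0 0
    refine ⟨fun _ => q, fun _ => hq, fun s F _ hFs => ?_⟩
    rw [prob_zero]
    split_ifs with h
    · rw [mul_one]
      refine measureReal_mono fun ω hω => ⟨hω, ?_⟩
      have : X k₀ ω = s := hFs hω
      simp only [mem_ofPred_eq, reachAvoid_zero, Fin.val_zero, add_zero, this]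
      exact ⟨h.1, good (fun _ => h.1) h.2⟩
    · rw [mul_zero]
      exact measureReal_nonneg
  | succ K ih =>
    obtain ⟨P', hP', hcmp⟩ := ih (k₀ + 1)
    set v : S → ℝ := fun s => prob K goal bad s (fun s k => π s (k₀ + 1 + k)) P' with hv
    obtain ⟨q, hq, hqv⟩ := hstep k₀ v
    have hP : (fun k => Nat.casesOn k q P' : ℕ → S → A → S → ℝ) ∈ I.Natures := by
      rintro (_ | k)
      exacts [hq, hP' k]
    refine ⟨_, hP, fun s F hF hFs => ?_⟩
    by_cases hb : s ∈ bad
    · rw [prob_eq_zero_of_mem _ hb, mul_zero]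
      exact measureReal_nonneg
    by_cases hg : s ∈ goal
    · refine (mul_le_of_le_one_right measureReal_nonneg
        (prob_le_one _ _ _ _ _ _ fun k => Transitions.mem_stdSimplex (hP k))).trans ?_
      refine measureReal_mono fun ω hω => ⟨hω, ?_⟩
      have : X k₀ ω = s := hFs hω
      simp only [mem_ofPred_eq, reachAvoid_succ, Fin.val_zero, add_zero, this]
      exact ⟨good (fun _ => hg) hb, Or.inl hg⟩
    by_cases he : I.enabled s = ∅
    · rw [prob_eq_zero_of_absorbing I _ he hg _ _ hP, mul_zero]
      exact measureReal_nonneg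
    have hpart : ∀ s', MeasurableSet (X (k₀ + 1) ⁻¹' {s'}) := fun s' => hle _ _ (hX _ s')
    calc μ.real F * prob (K + 1) goal bad s (fun s k => π s (k₀ + k)) _
        = μ.real F * ∑ s', q s (π s k₀) s' * v s' := by
          rw [prob_succ K hg hb]
          simp only [hv, add_zero, add_assoc, add_comm 1]
          rfl
      _ ≤ ∑ s', μ.real (F ∩ X (k₀ + 1) ⁻¹' {s'}) * v s' :=
          hqv s (nonempty_iff_ne_empty.2 he) F hF hFs
      _ ≤ ∑ s', μ.real (F ∩ {ω | ReachAvoid goal bad' fun k : Fin (K + 1 + 1) => X (k₀ + k) ω} ∩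
            X (k₀ + 1) ⁻¹' {s'}) := by
          refine Finset.sum_le_sum fun s' _ => (hcmp s' _
            ((hmono _ _ hF).inter (hX _ s')) inter_subset_right).trans ?_
          refine measureReal_mono ?_
          rintro ω ⟨⟨hω, hω'⟩, hR⟩
          have : X k₀ ω = s := hFs hω
          refine ⟨⟨hω, ?_⟩, hω'⟩
          simp only [mem_ofPred_eq, reachAvoid_succ, Fin.val_zero, add_zero, this, Fin.val_succ]
          refine ⟨good (fun h => absurd h he) hb, Or.inr ?_⟩
          simpa only [mem_ofPred_eq, add_assoc, add_comm 1] using hR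
      _ = _ := by
          exact sum_measureReal_inter_eq μ hpart (fun a b hab => Disjoint.preimage _
            (disjoint_singleton.2 hab)) fun ω _ => mem_iUnion.2 ⟨_, rfl⟩

end IMDP

namespace MultiTarget

variable {n m N M : ℕ} (D : MultiTarget n m N M)

/-! ### Transition probabilities of the abstract states -/

lemma absState_eq_some_iff (x : EuclideanSpace ℝ (Fin n)) (i : Fin N) :
    D.absState x = some i ↔ x ∈ D.Q i := by
  unfold absState
  split_ifs with h
  · rw [Option.some_inj]
    refine ⟨fun hi => hi ▸ h.choose_spec, fun hi => ?_⟩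
    by_contra hne
    exact Set.disjoint_left.1 (D.disjoint _ _ hne) h.choose_spec hi
  · exact iff_of_false (by simp) fun hi => h ⟨i, hi⟩

lemma absState_eq_none_iff (x : EuclideanSpace ℝ (Fin n)) :
    D.absState x = none ↔ x ∉ D.domain := by
  unfold absState domain
  split_ifs with h <;> simpa using h

lemma measurableSet_domain : MeasurableSet D.domain :=
  MeasurableSet.iUnion fun i => (D.polytope i).measurableSet

lemma measurableSet_absState_eq (s : Option (Fin N)) : MeasurableSet {x | D.absState x = s} := by
  cases s with
  | none =>
    simp only [absState_eq_none_iff]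
    exact D.measurableSet_domain.compl
  | some i =>
    simp only [absState_eq_some_iff]
    exact (D.polytope i).measurableSet

lemma measurableSet_region (s : Option (Fin N)) : MeasurableSet (D.region s) := by
  cases s with
  | none => exact isClosed_closure.measurableSet
  | some i => exact (D.polytope i).measurableSet

/-- The probability of reaching the abstract state `s` with nominal next state `c j` and noise
distribution `ν`. -/
noncomputable def transProb (ν : Measure (EuclideanSpace ℝ (Fin n))) (j : Fin N)
    (s : Option (Fin N)) : ℝ :=
  ν.real {w | D.absState (D.c j + w) = s}

/-- The regions of the abstract states overlap only in the boundary of the domain. This is contained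
in the boundaries of finitely many convex sets and hence a null set. -/
lemma transProb_eq_region {ν : Measure (EuclideanSpace ℝ (Fin n))} (hν : ν ≪ volume) (j : Fin N)
    (s : Option (Fin N)) : D.transProb ν j s = ν.real {w | D.c j + w ∈ D.region s} := by
  cases s with
  | some i => simp only [transProb, absState_eq_some_iff, region]
  | none =>
    have hnull : ν (⋃ i, (fun w => D.c j + w) ⁻¹' frontier (D.Q i)) = 0 := by
      rw [measure_iUnion_null_iff]
      intro i
      apply hν
      rw [measure_preimage_add]
      exact (D.polytope i).convex.addHaar_frontier volume
    refine measureReal_congr ((ae_iff.2 (measure_mono_null ?_ hnull)).mono fun w hw => hw)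
    intro w hw
    simp only [mem_ofPred_eq, eq_iff_iff] at hw
    change ¬ (D.absState (D.c j + w) = none ↔ D.c j + w ∈ closure D.domainᶜ) at hw
    rw [absState_eq_none_iff] at hw
    have h1 : D.c j + w ∈ D.domain := by
      by_contra h
      exact hw (iff_of_true h (subset_closure h))
    have h2 : D.c j + w ∈ closure D.domainᶜ := by
      by_contra h
      exact hw (iff_of_false (not_not.2 h1) h)
    obtain ⟨i, hi⟩ := mem_iUnion.1 h1
    refine mem_iUnion.2 ⟨i, ?_⟩
    rw [mem_preimage, frontier_eq_closure_inter_closure]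
    exact ⟨subset_closure hi, closure_mono (compl_subset_compl.2 (subset_iUnion D.Q i)) h2⟩

lemma transProb_mem_stdSimplex (ν : Measure (EuclideanSpace ℝ (Fin n))) [IsProbabilityMeasure ν]
    (j : Fin N) : D.transProb ν j ∈ stdSimplex ℝ (Option (Fin N)) := by
  refine ⟨fun s => measureReal_nonneg, ?_⟩
  have := sum_measureReal_inter_eq ν (C := univ)
    (A := fun s => {w | D.absState (D.c j + w) = s})
    (fun s => (measurable_const_add (D.c j)) (D.measurableSet_absState_eq s))
    (fun s t hst => Set.disjoint_left.2 fun w hs ht => hst (hs.symm.trans ht))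
    (fun w _ => mem_iUnion.2 ⟨_, rfl⟩)
  simp only [univ_inter, probReal_univ] at this
  exact this

/-- At a point of a cell with enabled action `r`, some reference point is selected. -/
lemma exists_selects {i : Fin N} {r : Fin M} (hr : r ∈ D.enabled (some i))
    {x : EuclideanSpace ℝ (Fin n)} (hx : x ∈ D.Q i) : ∃ j ∈ D.selected i r, D.Selects x r j := by
  have hne : {j | j ∈ D.T r ∧ x ∈ D.Pre (D.c j)}.Nonempty := by
    obtain ⟨j, hj, h⟩ := mem_iUnion₂.1 (hr hx)
    exact ⟨j, hj, h⟩
  obtain ⟨j, hj⟩ := (Set.toFinite _).exists_minimal hne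
  have : D.Selects x r j := ⟨hj.1, fun k hk => (le_total j k).elim id fun h => hj.2 hk h⟩
  exact ⟨j, ⟨x, hx, this⟩, this⟩

lemma selected_nonempty {i : Fin N} {r : Fin M} (hr : r ∈ D.enabled (some i)) :
    (D.selected i r).Nonempty :=
  let ⟨j, hj, _⟩ := D.exists_selects hr (D.c_mem i)
  ⟨j, hj⟩

/-! ### The controlled process -/

section Dynamics

variable (u : EuclideanSpace ℝ (Fin n) → Fin M → EuclideanSpace ℝ (Fin m))

lemma measurable_controller (hum : ∀ r, Measurable fun x => u x r)
    (π : Option (Fin N) → ℕ → Fin M) (k : ℕ) : Measurable (D.controller u π k) := by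
  intro A hA
  have : D.controller u π k ⁻¹' A =
      ⋃ s, {x | D.absState x = s} ∩ (fun x => u x (π s k)) ⁻¹' A := by
    ext x
    simp [controller]
  rw [this]
  exact MeasurableSet.iUnion fun s => (D.measurableSet_absState_eq s).inter (hum _ hA)

variable {Ω : Type*} (W : ℕ → Ω → EuclideanSpace ℝ (Fin n))

/-- The σ-algebra of the noise before time `k`. -/
abbrev past (k : ℕ) : MeasurableSpace Ω := ⨆ i ∈ Iio k, MeasurableSpace.comap (W i) inferInstance

lemma past_le_succ (k : ℕ) : past W k ≤ past W (k + 1) :=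
  biSup_mono fun _ h => lt_trans h (Nat.lt_succ_self k)

lemma past_le [mΩ : MeasurableSpace Ω] (hWm : ∀ k, Measurable (W k)) (k : ℕ) : past W k ≤ mΩ :=
  iSup₂_le fun i _ => (hWm i).comap_le

lemma measurable_past {i k : ℕ} (h : i < k) : Measurable[past W k] (W i) :=
  Measurable.of_comap_le (le_iSup₂_of_le (f := fun i (_ : i ∈ Iio k) =>
    MeasurableSpace.comap (W i) inferInstance) i h le_rfl)

lemma measurable_traj
    (hf : Measurable fun p : EuclideanSpace ℝ (Fin n) × EuclideanSpace ℝ (Fin m) => D.f p.1 p.2)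
    {φ : ℕ → EuclideanSpace ℝ (Fin n) → EuclideanSpace ℝ (Fin m)} (hφ : ∀ k, Measurable (φ k))
    (x₀ : EuclideanSpace ℝ (Fin n)) (k : ℕ) : Measurable[past W k] (D.traj W φ x₀ k) := by
  induction k with
  | zero => exact @measurable_const _ _ _ (past W 0) x₀
  | succ k ih =>
    have h1 : Measurable fun x => D.f x (φ k x) := hf.comp (measurable_id.prodMk (hφ k))
    let := past W (k + 1)
    exact (h1.comp (ih.mono (past_le_succ W k) le_rfl)).add (measurable_past W k.lt_succ_self)

/-- The one-step comparison: on a past event on which the process is in the cell `i`, split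
according to the reference point to which the controller steers. On each of the parts, which are
past events as well, the noise is independent and leads to the distribution `D.transProb ν j`. -/
lemma measureReal_mul_le_sum [MeasurableSpace Ω] (μ : Measure Ω) [IsProbabilityMeasure μ]
    (hf : Measurable fun p : EuclideanSpace ℝ (Fin n) × EuclideanSpace ℝ (Fin m) => D.f p.1 p.2)
    (hu : D.IsControlLaw u) (hum : ∀ r, Measurable fun x => u x r)
    (hWm : ∀ k, Measurable (W k)) (hWindep : iIndepFun W μ)
    (hWident : ∀ k, IdentDistrib (W k) (W 0) μ μ) (x₀ : EuclideanSpace ℝ (Fin n))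
    (π : Option (Fin N) → ℕ → Fin M) (k : ℕ) (v : Option (Fin N) → ℝ) {b : ℝ} {i : Fin N}
    (hr : π (some i) k ∈ D.enabled (some i))
    (hb : ∀ j ∈ D.selected i (π (some i) k), b ≤ ∑ s, D.transProb (μ.map (W 0)) j s * v s)
    {F : Set Ω} (hF : MeasurableSet[past W k] F)
    (hFi : F ⊆ (fun ω => D.absState (D.traj W (D.controller u π) x₀ k ω)) ⁻¹' {some i}) :
    μ.real F * b ≤ ∑ s, μ.real (F ∩
      (fun ω => D.absState (D.traj W (D.controller u π) x₀ (k + 1) ω)) ⁻¹' {s}) * v s := by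
  have hφ := D.measurable_controller u hum π
  have hXm := D.measurable_traj W hf hφ x₀ k
  set X := D.traj W (D.controller u π) x₀ k with hX
  set X' := D.traj W (D.controller u π) x₀ (k + 1) with hX'
  have hle := past_le W hWm
  set Y : Ω → EuclideanSpace ℝ (Fin n) := fun ω => D.f (X ω) (D.controller u π k (X ω)) with hY
  have hYm : Measurable[past W k] Y :=
    (hf.comp (measurable_id.prodMk (hφ k))).comp hXm
  have hYs : ∀ j, MeasurableSet[past W k] (Y ⁻¹' {D.c j}) := fun j =>
    hYm (measurableSet_singleton _)
  have hinj : Function.Injective D.c := by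
    intro a b hab
    by_contra hne
    exact Set.disjoint_left.1 (D.disjoint a b hne) (D.c_mem a) (hab ▸ D.c_mem b)
  have hdisj : Pairwise fun a b => Disjoint (Y ⁻¹' {D.c a}) (Y ⁻¹' {D.c b}) := fun a b hab =>
    Disjoint.preimage _ (disjoint_singleton.2 (hinj.ne hab))
  have hsel : ∀ ω ∈ F, ∃ j ∈ D.selected i (π (some i) k), Y ω = D.c j := by
    intro ω hω
    have hs : D.absState (X ω) = some i := hFi hω
    obtain ⟨j, hj, hsel⟩ := D.exists_selects hr ((D.absState_eq_some_iff _ _).1 hs)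
    refine ⟨j, hj, ?_⟩
    simp only [hY, controller, hs]
    exact hu.2 _ _ _ hsel
  have hcov : F ⊆ ⋃ j, Y ⁻¹' {D.c j} := fun ω hω =>
    let ⟨j, _, hj⟩ := hsel ω hω
    mem_iUnion.2 ⟨j, hj⟩
  have hYs' : ∀ j, MeasurableSet (Y ⁻¹' {D.c j}) := fun j => hle k _ (hYs j)
  have hind : ∀ j s, μ.real (F ∩ Y ⁻¹' {D.c j}) * D.transProb (μ.map (W 0)) j s =
      μ.real (F ∩ (fun ω => D.absState (X' ω)) ⁻¹' {s} ∩ Y ⁻¹' {D.c j}) := by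
    intro j s
    have hm : MeasurableSet {w | D.absState (D.c j + w) = s} :=
      (measurable_const_add (D.c j)) (D.measurableSet_absState_eq s)
    have hI := indep_iSup_of_disjoint (fun i => (hWm i).comap_le) hWindep.iIndep
      (show Disjoint (Iio k) {k} by simp)
    have hmul := (Indep_iff _ _ _).1 hI (F ∩ Y ⁻¹' {D.c j})
      (W k ⁻¹' {w | D.absState (D.c j + w) = s}) (hF.inter (hYs j)) (by
        rw [iSup_singleton]
        exact ⟨_, hm, rfl⟩)
    have hset : F ∩ (fun ω => D.absState (X' ω)) ⁻¹' {s} ∩ Y ⁻¹' {D.c j} =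
        F ∩ Y ⁻¹' {D.c j} ∩ W k ⁻¹' {w | D.absState (D.c j + w) = s} := by
      rw [inter_right_comm]
      ext ω
      simp only [mem_inter_iff, mem_preimage, mem_singleton_iff, mem_ofPred_eq]
      refine and_congr_right fun h => ?_
      rw [← h.2]
      rfl
    rw [hset, measureReal_def, measureReal_def, hmul, ENNReal.toReal_mul, transProb,
      ← (hWident k).map_eq, map_measureReal_apply (hWm k) hm, measureReal_def]
  calc μ.real F * b = ∑ j, μ.real (F ∩ Y ⁻¹' {D.c j}) * b := by
        rw [← Finset.sum_mul, sum_measureReal_inter_eq μ hYs' hdisj hcov]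
    _ ≤ ∑ j, μ.real (F ∩ Y ⁻¹' {D.c j}) * ∑ s, D.transProb (μ.map (W 0)) j s * v s := by
        refine Finset.sum_le_sum fun j _ => ?_
        rcases (F ∩ Y ⁻¹' {D.c j}).eq_empty_or_nonempty with he | ⟨ω, hω, hωj⟩
        · simp [he]
        · obtain ⟨j', hj', hYj⟩ := hsel ω hω
          obtain rfl : j = j' := hinj (hωj.symm.trans hYj)
          exact mul_le_mul_of_nonneg_left (hb j hj') measureReal_nonneg
    _ = ∑ s, (∑ j, μ.real (F ∩ (fun ω => D.absState (X' ω)) ⁻¹' {s} ∩ Y ⁻¹' {D.c j})) * v s := by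
        simp only [Finset.mul_sum, Finset.sum_mul, ← mul_assoc, hind]
        exact Finset.sum_comm
    _ = _ := by
        refine Finset.sum_congr rfl fun s _ => ?_
        rw [sum_measureReal_inter_eq μ hYs' hdisj (inter_subset_left.trans hcov)]

end Dynamics

/-! ### Correct intervals -/

/-- All of the intervals that enter the iMDP contain the true transition probabilities. -/
def IntervalsCorrect {Z : ℕ} (ν : Measure (EuclideanSpace ℝ (Fin n))) (β : ℝ)
    (w : Fin Z → EuclideanSpace ℝ (Fin n)) : Prop :=
  ∀ i r, r ∈ D.enabled (some i) → ∀ j ∈ D.selected i r, ∀ s,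
    D.transProb ν j s ∈ Icc (pLower Z β (D.numOut w j s)) (pUpper Z β (D.numOut w j s))

/-- The reference points that are selected under some enabled action. -/
noncomputable def selectedPoints : Finset (Fin N) :=
  Finset.univ.filter fun j => ∃ i r, r ∈ D.enabled (some i) ∧ j ∈ D.selected i r

lemma card_selectedPoints_le : D.selectedPoints.card ≤ M * D.Lmax := by
  have hsub : D.selectedPoints ⊆ Finset.univ.biUnion fun r : Fin M =>
      Finset.univ.filter fun j => ∃ i, r ∈ D.enabled (some i) ∧ j ∈ D.selected i r := by
    intro j hj
    obtain ⟨i, r, h⟩ := (Finset.mem_filter.1 hj).2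
    exact Finset.mem_biUnion.2 ⟨r, Finset.mem_univ _, Finset.mem_filter.2 ⟨Finset.mem_univ _, i, h⟩⟩
  refine (Finset.card_le_card hsub).trans ((Finset.card_biUnion_le_card_mul _ _ D.Lmax
    fun r _ => ?_).trans (by simp))
  refine le_trans (le_of_eq ?_) (Finset.le_sup (f := D.L) (Finset.mem_univ r))
  rw [L, ← Set.ncard_coe_finset]
  congr 1
  ext j
  simp

/-- The union bound over all selected reference points and all abstract states. The intervals of one
of them fail with probability `β / 2` at most, and `(N + 1) / 2 ≤ N`. -/
lemma one_sub_le_measureReal_intervalsCorrect {ν : Measure (EuclideanSpace ℝ (Fin n))}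
    [IsProbabilityMeasure ν] (hν : ν ≪ volume) (Z : ℕ) {β : ℝ} (hβ₀ : 0 < β) (hβ₁ : β < 1) :
    1 - β * N * M * D.Lmax ≤
      (Measure.pi fun _ : Fin Z => ν).real {w | D.IntervalsCorrect ν β w} := by
  set P := Measure.pi fun _ : Fin Z => ν
  let bad : Fin N × Option (Fin N) → Set (Fin Z → EuclideanSpace ℝ (Fin n)) := fun p =>
    {w | D.transProb ν p.1 p.2 ∉
      Icc (pLower Z β (D.numOut w p.1 p.2)) (pUpper Z β (D.numOut w p.1 p.2))}
  have hbad : ∀ p, P.real (bad p) ≤ β / 2 := by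
    rintro ⟨j, s⟩
    have := measureReal_notMem_Icc_le ν Z hβ₀ hβ₁
      ((measurable_const_add (D.c j)) (D.measurableSet_region s))
    simp only [bad, D.transProb_eq_region hν]
    exact this
  have hcov : (univ : Set (Fin Z → EuclideanSpace ℝ (Fin n))) ⊆
      {w | D.IntervalsCorrect ν β w} ∪ ⋃ p ∈ D.selectedPoints ×ˢ Finset.univ, bad p := by
    intro w _
    by_contra h
    rw [mem_union, not_or] at h
    refine h.1 fun i r hr j hj s => ?_
    by_contra hjs
    exact h.2 (mem_iUnion₂.2 ⟨(j, s), Finset.mem_product.2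
      ⟨Finset.mem_filter.2 ⟨Finset.mem_univ _, i, r, hr, hj⟩, Finset.mem_univ _⟩, hjs⟩)
  have h1 : (1 : ℝ) ≤ P.real {w | D.IntervalsCorrect ν β w} +
      (D.selectedPoints ×ˢ (Finset.univ : Finset (Option (Fin N)))).card • (β / 2) := by
    rw [← probReal_univ (μ := P)]
    exact (measureReal_mono hcov).trans ((measureReal_union_le _ _).trans (add_le_add le_rfl
      ((measureReal_biUnion_finset_le _ _).trans
        (Finset.sum_le_card_nsmul _ _ _ fun p _ => hbad p))))
  have h2 : (D.selectedPoints ×ˢ (Finset.univ : Finset (Option (Fin N)))).card • (β / 2) ≤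
      β * N * M * D.Lmax := by
    rw [Finset.card_product, Finset.card_univ, Fintype.card_option, Fintype.card_fin, nsmul_eq_mul]
    have hcM : (D.selectedPoints.card : ℝ) ≤ M * D.Lmax := by
      exact_mod_cast D.card_selectedPoints_le
    rcases Nat.eq_zero_or_pos N with rfl | hN
    · simp [show D.selectedPoints = ∅ from Finset.eq_empty_of_isEmpty _]
    · have hN1 : (1 : ℝ) ≤ N := by exact_mod_cast hN
      push_cast
      calc (D.selectedPoints.card : ℝ) * (N + 1) * (β / 2) ≤ M * D.Lmax * (2 * N) * (β / 2) := by
            gcongr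
            linarith
        _ = _ := by ring
  linarith

lemma mem_Icc_of_intervalsCorrect {Z : ℕ} {ν : Measure (EuclideanSpace ℝ (Fin n))} {β : ℝ}
    {w : Fin Z → EuclideanSpace ℝ (Fin n)} (hw : D.IntervalsCorrect ν β w) {i : Fin N} {r : Fin M}
    (hr : r ∈ D.enabled (some i)) {j : Fin N} (hj : j ∈ D.selected i r) (s : Option (Fin N)) :
    D.transProb ν j s ∈ Icc ((D.imdp β w).lo (some i) r s) ((D.imdp β w).hi (some i) r s) := by
  have hmem : D.transProb ν j s ∈ D.robustSet β w i r s :=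
    mem_iUnion₂.2 ⟨j, hj, hw i r hr j hj s⟩
  have hfin := Set.toFinite (D.selected i r)
  exact ⟨csInf_le ((hfin.bddBelow_biUnion).2 fun _ _ => bddBelow_Icc) hmem,
    le_csSup ((hfin.bddAbove_biUnion).2 fun _ _ => bddAbove_Icc) hmem⟩

/-- If the intervals are correct, nature may choose at every state and action the true transition
probabilities of the selected reference point for which the expected value of `v` is minimal. -/
lemma exists_transitions_le {Z : ℕ} {ν : Measure (EuclideanSpace ℝ (Fin n))}
    [IsProbabilityMeasure ν] {β : ℝ} {w : Fin Z → EuclideanSpace ℝ (Fin n)}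
    (hw : D.IntervalsCorrect ν β w) (v : Option (Fin N) → ℝ) :
    ∃ q ∈ (D.imdp β w).Transitions, ∀ i, ∀ r ∈ D.enabled (some i), ∀ j ∈ D.selected i r,
      ∑ s, q (some i) r s * v s ≤ ∑ s, D.transProb ν j s * v s := by
  have hmin : ∀ s a, ∃ q : Option (Fin N) → ℝ,
      ((a ∈ D.enabled s → q ∈ stdSimplex ℝ (Option (Fin N)) ∧
        ∀ s', q s' ∈ Icc ((D.imdp β w).lo s a s') ((D.imdp β w).hi s a s')) ∧
      (a ∉ D.enabled s → q = Pi.single s 1)) ∧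
      ∀ i, s = some i → a ∈ D.enabled s → ∀ j ∈ D.selected i a,
        ∑ s', q s' * v s' ≤ ∑ s', D.transProb ν j s' * v s' := by
    intro s a
    by_cases ha : a ∈ D.enabled s
    · cases s with
      | none => exact absurd ha (notMem_empty a)
      | some i =>
        obtain ⟨j, hj, hle⟩ := Set.exists_min_image (D.selected i a)
          (fun j => ∑ s', D.transProb ν j s' * v s') (Set.toFinite _) (D.selected_nonempty ha)
        refine ⟨D.transProb ν j, ⟨fun _ => ⟨D.transProb_mem_stdSimplex ν j,
          D.mem_Icc_of_intervalsCorrect hw ha hj⟩, fun h => absurd ha h⟩, ?_⟩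
        rintro i' hi - j' hj'
        obtain rfl := Option.some_inj.1 hi
        exact hle j' hj'
    · exact ⟨Pi.single s 1, ⟨fun h => absurd h ha, fun _ => rfl⟩, fun _ _ h => absurd h ha⟩
  choose q hq hqv using hmin
  refine ⟨q, mem_ofPred.2 fun s a => ⟨(hq s a).1, fun h => ?_⟩,
    fun i r hr => hqv (some i) r i rfl hr⟩
  -- `IMDP.Transitions` uses the classical decidable equality in `Pi.single`, `hq` that of `Option`
  convert (hq s a).2 h

lemma satEvent_eq {Ω : Type*} (W : ℕ → Ω → EuclideanSpace ℝ (Fin n)) (K : ℕ) (G B : Set (Fin N))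
    (φ : ℕ → EuclideanSpace ℝ (Fin n) → EuclideanSpace ℝ (Fin m))
    (x₀ : EuclideanSpace ℝ (Fin n)) :
    D.satEvent W K G B φ x₀ = {ω | ReachAvoid (some '' G) (some '' B ∪ {none})
      fun k : Fin (K + 1) => D.absState (D.traj W φ x₀ k ω)} := by
  have hcell : ∀ (C : Set (Fin N)) x, x ∈ D.cells C ↔ D.absState x ∈ some '' C := fun C x => by
    simp only [cells, mem_iUnion, mem_image, eq_comm (b := D.absState x), absState_eq_some_iff,
      exists_prop]
  ext ω
  simp only [satEvent, ReachAvoid, mem_ofPred_eq, mem_union, hcell, mem_compl_iff,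
    mem_singleton_iff, absState_eq_none_iff]

/-- Under correct intervals, the controlled system satisfies the specification with at least the
worst-case probability of the iMDP. -/
lemma worstProb_le_measureReal_satEvent
    (hf : Measurable fun p : EuclideanSpace ℝ (Fin n) × EuclideanSpace ℝ (Fin m) => D.f p.1 p.2)
    (u : EuclideanSpace ℝ (Fin n) → Fin M → EuclideanSpace ℝ (Fin m))
    (hu : D.IsControlLaw u) (hum : ∀ r, Measurable fun x => u x r)
    {Ω : Type*} [MeasurableSpace Ω] (μ : Measure Ω) [IsProbabilityMeasure μ]
    (W : ℕ → Ω → EuclideanSpace ℝ (Fin n)) (hWm : ∀ k, Measurable (W k))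
    (hWindep : iIndepFun W μ) (hWident : ∀ k, IdentDistrib (W k) (W 0) μ μ)
    (K : ℕ) (G B : Set (Fin N)) (x₀ : EuclideanSpace ℝ (Fin n)) {Z : ℕ} {β : ℝ}
    {w : Fin Z → EuclideanSpace ℝ (Fin n)} (hw : D.IntervalsCorrect (μ.map (W 0)) β w)
    {π : Option (Fin N) → ℕ → Fin M} (hπ : π ∈ (D.imdp β w).Admissible) :
    (D.imdp β w).worstProb K (some '' G) (some '' B) (D.absState x₀) π ≤
      μ.real (D.satEvent W K G B (D.controller u π) x₀) := by
  have : IsProbabilityMeasure (μ.map (W 0)) := Measure.isProbabilityMeasure_map (hWm 0).aemeasurable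
  obtain ⟨P, hP, hle⟩ := IMDP.exists_nature_mul_prob_le μ (D.imdp β w) (some '' G) (some '' B)
    (some '' B ∪ {none}) (fun k ω => D.absState (D.traj W (D.controller u π) x₀ k ω)) (past W)
    (past_le_succ W) (past_le W hWm)
    (fun k s => D.measurable_traj W hf (D.measurable_controller u hum π) x₀ k
      (D.measurableSet_absState_eq s))
    (by
      rintro s (hs | rfl) hsB
      · exact absurd hs hsB
      · exact ⟨rfl, by simp⟩) π
    (fun k v => by
      obtain ⟨q, hq, hqv⟩ := D.exists_transitions_le hw v
      refine ⟨q, hq, fun s hs F hF hFs => ?_⟩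
      cases s with
      | none => exact absurd hs not_nonempty_empty
      | some i =>
        exact D.measureReal_mul_le_sum u W μ hf hu hum hWm hWindep hWident x₀ π k v (hπ _ k hs)
          (hqv i _ (hπ _ k hs)) hF hFs) K 0
  refine (IMDP.worstProb_le _ K _ _ _ π hP).trans ?_
  have h := hle (D.absState x₀) univ MeasurableSet.univ fun ω _ => rfl
  simpa only [probReal_univ, one_mul, univ_inter, zero_add, ← D.satEvent_eq] using h

end MultiTarget

theorem theorem2 {n m N M : ℕ} (D : MultiTarget n m N M)
    (hf : Measurable fun p : EuclideanSpace ℝ (Fin n) × EuclideanSpace ℝ (Fin m) => D.f p.1 p.2)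
    (u : EuclideanSpace ℝ (Fin n) → Fin M → EuclideanSpace ℝ (Fin m))
    (hu : D.IsControlLaw u) (hum : ∀ r, Measurable fun x => u x r)
    {Ω : Type*} [MeasurableSpace Ω] (μ : Measure Ω) [IsProbabilityMeasure μ]
    (W : ℕ → Ω → EuclideanSpace ℝ (Fin n)) (hWm : ∀ k, Measurable (W k))
    (hWindep : iIndepFun W μ) (hWident : ∀ k, IdentDistrib (W k) (W 0) μ μ)
    (hWpdf : ∀ k, HasPDF (W k) μ volume)
    (K : ℕ) (G B : Set (Fin N)) (x₀ : EuclideanSpace ℝ (Fin n))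
    (Z : ℕ) (β : ℝ) (hβ₀ : 0 < β) (hβ₁ : β < 1) :
    1 - β * N * M * D.Lmax ≤
      (Measure.pi fun _ : Fin Z => μ.map (W 0)).real
        {w | ∀ π, (D.imdp β w).IsOptimal K (some '' G) (some '' B) (D.absState x₀) π →
          ∀ η : ℝ, η ≤ (D.imdp β w).worstProb K (some '' G) (some '' B) (D.absState x₀) π →
            η ≤ μ.real (D.satEvent W K G B (D.controller u π) x₀)} := by
  have : IsProbabilityMeasure (μ.map (W 0)) := Measure.isProbabilityMeasure_map (hWm 0).aemeasurable
  have := hWpdf 0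
  refine (D.one_sub_le_measureReal_intervalsCorrect HasPDF.absolutelyContinuous Z hβ₀ hβ₁).trans
    (measureReal_mono fun w hw π hπ η hη => hη.trans ?_)
  exact D.worstProb_le_measureReal_satEvent hf u hu hum μ W hWm hWindep hWident K G B x₀ hw hπ.1
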